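/- Let $m\ge 0$ and $k$ be integers, and let $\mathcal{G}$ be a set of colored chains $(c_1\prec c_2\prec\dots\prec c_\ell)$ with colors $c_j\in\{1,\dots,m\}$ and lengths $2\le \ell\le k$. Assume that for every color $i$ the set $\mathcal{G}$ contains a monochromatic chain $(i\prec i\prec\dots\prec i)$. Let $\overline\beta=(\beta_1,\dots,\beta_m)$ be positive real numbers. A colored subset of $\mathcal{P}([n])$ is a set $S\subseteq\mathcal{P}([n])$ with a coloring $c:S\to\{1,\dots,m\}$. It is valid if there are no $(c_1\prec\dots\prec c_\ell)\in\mathcal{G}$ and $x_1\subsetneq x_2\subsetneq\dots\subsetneq x_\ell$ in $S$ with $c(x_j)=c_j$ for all $j$. Let $\Lambda(\mathcal{G},n)$ be the collection of valid colored subsets of $\mathcal{P}([n])$, and put $$\mu(\overline\beta,\Lambda(\mathcal{G},n))=\sum_{(S,c)\in\Lambda(\mathcal{G},n)}\ \prod_{x\in S}\beta_{c(x)}.$$ A template on $\mathcal{P}([n])$ is a function $T:\mathcal{P}([n])\to\mathcal{P}(\{1,\dots,m\})$. Its support is $\{x: T(x)\ne\emptyset\}$, and it is supported on $A$ if $A$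 contains its support. It is valid if every coloring of its support that gives each $x$ a color in $T(x)$ is valid. Its weighted entropy is $\omega(\overline\beta,T)=\sum_{x\in\mathcal{P}([n])}\log\bigl(1+\sum_{i\in T(x)}\beta_i\bigr)$. Then, as $T$ ranges over the valid templates on $\mathcal{P}([N])$, for all $N\ge 0$, that are supported on a chain of $\mathcal{P}([N])$, the maximum $$\omega_{crit}(\overline\beta)=\max_T\ \omega(\overline\beta,T)$$ exists, and, as $n\to\infty$ with $m,\mathcal{G},\overline\beta$ fixed, $$\mu(\overline\beta,\Lambda(\mathcal{G},n))=e^{\omega_{crit}(\overline\beta)\binom{n}{\lfloor n/2\rfloor}(1+o(1))}.$$ -/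

import Mathlib

open Filter Topology

namespace ColoredChains

/-- The Boolean lattice `𝒫([n])`, ordered by inclusion. -/
abbrev Cube (n : ℕ) : Type := Finset (Fin n)

/-- A colored subset of `𝒫([n])` with `m` colors: a set `S` with a coloring `S → [m]`,
encoded as the partial function which is `none` exactly outside of `S`. -/
abbrev ColoredSubset (m n : ℕ) : Type := Cube n → Option (Fin m)

/-- A colored chain `c₁ ≺ c₂ ≺ ⋯ ≺ c_ℓ` is the list of its colors, from bottom to top. It appears
in a colored subset if there are sets `x₁ ⊂ x₂ ⊂ ⋯ ⊂ x_ℓ` in it such that `x_j` has color `c_j`. -/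
def Appears {m n : ℕ} (g : List (Fin m)) (c : ColoredSubset m n) : Prop :=
  ∃ x : Fin g.length → Cube n, StrictMono x ∧ ∀ j, c (x j) = some (g.get j)

/-- A colored subset is valid if no forbidden colored chain appears in it. -/
def IsValid {m n : ℕ} (G : Set (List (Fin m))) (c : ColoredSubset m n) : Prop :=
  ∀ g ∈ G, ¬ Appears g c

/-- `G` contains a monochromatic chain of every color. -/
def IsSparse {m : ℕ} (G : Set (List (Fin m))) : Prop :=
  ∀ i : Fin m, ∃ l : ℕ, List.replicate l i ∈ G

/-- The collection `Λ(G, n)` of valid colored subsets of `𝒫([n])`. -/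
noncomputable def validSubsets {m : ℕ} (G : Set (List (Fin m))) (n : ℕ) :
    Finset (ColoredSubset m n) :=
  (Set.toFinite {c : ColoredSubset m n | IsValid G c}).toFinset

/-- The weight of one colored subset: the product of `β (color of x)` over its elements `x`
(elements outside of the subset contribute the factor `1`). -/
def weight {m n : ℕ} (β : Fin m → ℝ) (c : ColoredSubset m n) : ℝ :=
  ∏ x : Cube n, (c x).elim 1 β

/-- The `β`-weighted measure of a collection of colored subsets. -/
def measure {m n : ℕ} (β : Fin m → ℝ) (Λ : Finset (ColoredSubset m n)) : ℝ :=
  ∑ c ∈ Λ, weight β c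

/-- A template on `𝒫([n])`: a set of colors at each element. -/
abbrev Template (m n : ℕ) : Type := Cube n → Finset (Fin m)

namespace Template

variable {m n : ℕ}

/-- `T` is supported on `A` if `T x = ∅` for every `x ∉ A`. -/
def SupportedOn (T : Template m n) (A : Set (Cube n)) : Prop :=
  ∀ x, x ∉ A → T x = ∅

/-- The smallest set on which `T` is supported. -/
def supp (T : Template m n) : Set (Cube n) := {x | T x ≠ ∅}

/-- `c` is a coloring of exactly `supp T`, which gives each `x ∈ supp T` a color in `T x`. -/
def IsColoring (T : Template m n) (c : ColoredSubset m n) : Prop :=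
  (∀ x ∈ T.supp, ∃ i ∈ T x, c x = some i) ∧ ∀ x ∉ T.supp, c x = none

/-- A template is valid if each coloring of its support with colors from it is valid. -/
def Valid (G : Set (List (Fin m))) (T : Template m n) : Prop :=
  ∀ c : ColoredSubset m n, T.IsColoring c → IsValid G c

/-- The weighted entropy `ω(β, T)`. -/
noncomputable def entropy (β : Fin m → ℝ) (T : Template m n) : ℝ :=
  ∑ x : Cube n, Real.log (1 + ∑ i ∈ T x, β i)

end Template

/-- The values `ω(β, T)`, for `T` a valid template (on `𝒫([n])` for any `n`) supported on
a chain. -/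
def chainEntropies {m : ℕ} (G : Set (List (Fin m))) (β : Fin m → ℝ) : Set ℝ :=
  {w | ∃ (n : ℕ) (T : Template m n), T.Valid G ∧
    (∃ A : Set (Cube n), IsChain (· ⊆ ·) A ∧ T.SupportedOn A) ∧ w = T.entropy β}

/-- The critical exponent `ω_crit(β)`. -/
noncomputable def omegaCrit {m : ℕ} (G : Set (List (Fin m))) (β : Fin m → ℝ) : ℝ :=
  sSup (chainEntropies G β)

end ColoredChains

/-! Upper bound: valid colored subsets become independent sets of a graph. Each element x is
recorded with its color and with the set of color words of length at most k that start at x. If x <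
y, prefixing a short word of y with the color of x must give a word of x, so compatibility concerns
pairs only (`Conflict`). Conversely, conflict-free vertices with admissible refined colors form a
valid template (`valid_colorsOf`).

Branching on vertices of degree above d (`sum_le_of_maxDegree_bound`) reduces the measure to vertex
sets B of maximum degree at most d. Their entropy is averaged over random maximal chains
(`entropy_colorsOf_le`). On a chain without conflicts B is a valid template, of entropy at most
ω_crit. Two nested sets, neither empty nor full, rarely lie on the same random chain, so for d =
o(n) the expected number of conflicts is o(1). Sparsity makes every admissible refined color
conflict with itself, which bounds the vertices on a chain by a constant plus the number of
conflicts.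

Lower bound: a valid template on a chain has at most one nonempty value per layer. Copying these
values to whole layers from the middle upwards keeps validity (`Template.valid_spread`), and each
such layer has asymptotically the middle size. The maximum exists because sparsity bounds the
support on a chain by m * k. -/

namespace ColoredChains

open Finset Numbering
open scoped Nat

/-! ### Random maximal chains -/

section Numberings

variable {X : Type*} [Fintype X] [DecidableEq X]

/-- The prefixes of a numbering form a maximal chain of subsets, and `prefixed s` consists of the
numberings whose chain passes through s. So a random maximal chain contains s with probability one
over the binomial coefficient. -/
theorem card_prefixed_mul_choose (s : Finset X) :
    #(prefixed s) * (Fintype.card X).choose #s = (Fintype.card X)! := by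
  rw [card_prefixed, ← Nat.choose_mul_factorial_mul_factorial s.card_le_univ]
  ring

theorem card_prefixed_inter_le {s t : Finset X} (hst : s ⊆ t) :
    #(prefixed s ∩ prefixed t) ≤ (#s)! * ((#t - #s)! * (Fintype.card X - #t)!) := by
  classical
  let t' : Finset ↥(sᶜ) := t.subtype (· ∈ sᶜ)
  have ht' : #t' = #t - #s := by
    rw [card_subtype, ← card_sdiff_of_subset hst]
    congr 1
    ext x
    simp
  have hcard : #(univ ×ˢ prefixed t' : Finset (Numbering s × Numbering ↥(sᶜ))) =
      (#s)! * ((#t - #s)! * (Fintype.card X - #t)!) := by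
    rw [card_product, card_univ, card_prefixed, Fintype.card_numbering, ht', Fintype.card_coe,
      Fintype.card_coe, card_compl]
    have := card_le_card hst
    rw [show Fintype.card X - #s - (#t - #s) = Fintype.card X - #t by omega]
  rw [← hcard]
  -- A numbering with prefix s splits into one of s and one of the complement, the latter having t \
  -- s as a prefix. The second branch is a dummy value, never used on the intersection.
  refine card_le_card_of_injOn
    (fun f => if h : f ∈ prefixed s then prefixedEquiv s ⟨f, h⟩ else
      (Fintype.equivFin _, Fintype.equivFin _)) ?_ ?_
  · intro f hf
    simp only [coe_inter, Set.mem_inter_iff, mem_coe] at hf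
    simp only [hf.1, dite_true, coe_product, Set.mem_prod, coe_univ, Set.mem_univ, true_and,
      mem_coe, mem_prefixed]
    intro x
    have h1 := mem_prefixed.1 hf.2 x
    have h2 := (mem_prefixed.1 hf.1 x).not.1 (Finset.mem_compl.1 x.2)
    have h3 : (((prefixedEquiv s ⟨f, hf.1⟩).2 x : Fin _) : ℕ) = f x - #s := rfl
    rw [h3, ht', mem_subtype, h1]
    have := card_le_card hst
    omega
  · intro f hf g hg h
    simp only [coe_inter, Set.mem_inter_iff, mem_coe] at hf hg
    simp only [hf.1, hg.1, dite_true] at h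
    simpa using (prefixedEquiv s).injective h

theorem le_choose {N j : ℕ} (h0 : 0 < j) (hN : j < N) : N ≤ N.choose j := by
  induction N with
  | zero => omega
  | succ N ih =>
    obtain ⟨j, rfl⟩ := Nat.exists_eq_succ_of_ne_zero h0.ne'
    rw [Nat.succ_eq_add_one, Nat.choose_succ_succ]
    rcases Nat.lt_or_ge (j + 1) N with h | h
    · have := ih h
      have := Nat.choose_pos (n := N) (k := j) (by omega)
      omega
    · have : N = j + 1 := by omega
      subst this
      simp

theorem mul_factorial_mul_factorial_le {i j : ℕ} (hi : 0 < i) (hj : 0 < j) :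
    (i + j) * (i ! * j !) ≤ (i + j)! := by
  have h := Nat.choose_mul_factorial_mul_factorial (Nat.le_add_right i j)
  rw [Nat.add_sub_cancel_left, mul_assoc] at h
  rw [← h]
  exact Nat.mul_le_mul_right _ (le_choose hi (by omega))

/-- Given s, the chain passes through t with probability at most 1 / (n - #s), since t ≠ univ; given
t, it passes through s with probability at most 1 / #t, since s ≠ ∅. One of the two is at most 2 /
n, according to whether #s is below or above n / 2. -/
theorem card_mul_card_prefixed_inter_le {s t : Finset X} (hst : s ⊂ t) (hs : s ≠ ∅)
    (ht : t ≠ univ) {n : ℕ} (hn : Fintype.card X = n) :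
    n * #(prefixed s ∩ prefixed t) ≤ 2 * (#(prefixed s) + #(prefixed t)) := by
  have h := card_prefixed_inter_le hst.subset
  have h1 := card_lt_card hst
  have h2 : 0 < #s := card_pos.2 (nonempty_iff_ne_empty.2 hs)
  have h3 : #t < Fintype.card X := by
    rw [← card_univ]
    exact card_lt_card (ssubset_univ_iff.2 ht)
  rw [card_prefixed s, card_prefixed t]
  refine (Nat.mul_le_mul_left _ h).trans ?_
  clear h
  rw [hn] at h3 ⊢
  generalize #s = a at *
  generalize #t = b at *
  rcases Nat.le_total (2 * a) n with ha | ha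
  · have h4 := mul_factorial_mul_factorial_le (i := b - a) (j := n - b) (by omega) (by omega)
    rw [show b - a + (n - b) = n - a by omega] at h4
    calc n * (a ! * ((b - a)! * (n - b)!)) ≤ (2 * (n - a)) * (a ! * ((b - a)! * (n - b)!)) :=
          Nat.mul_le_mul_right _ (by omega)
      _ = 2 * (a ! * ((n - a) * ((b - a)! * (n - b)!))) := by ring
      _ ≤ 2 * (a ! * (n - a)!) := by gcongr
      _ ≤ _ := by omega
  · have h4 := mul_factorial_mul_factorial_le (i := a) (j := b - a) (by omega) (by omega)
    rw [show a + (b - a) = b by omega] at h4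
    calc n * (a ! * ((b - a)! * (n - b)!)) ≤ (2 * b) * (a ! * ((b - a)! * (n - b)!)) :=
          Nat.mul_le_mul_right _ (by omega)
      _ = 2 * (b * (a ! * (b - a)!) * (n - b)!) := by ring
      _ ≤ 2 * (b ! * (n - b)!) := by gcongr
      _ ≤ _ := by omega

theorem isChain_isPrefix {X : Type*} [Fintype X] (f : Numbering X) :
    IsChain (· ⊆ ·) {s : Finset X | f.IsPrefix s} := by
  intro s hs t ht _
  exact (Nat.le_total #s #t).imp (hs.subset_of_card_le_card ht)
    (ht.subset_of_card_le_card hs)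

/-- Weighted LYM inequality: a total over the cube is at most the middle binomial coefficient times
the average total over a maximal chain. -/
theorem factorial_mul_sum_le (ψ : Finset X → ℝ) (hψ : ∀ x, 0 ≤ ψ x) {n : ℕ}
    (hn : Fintype.card X = n) :
    n ! * ∑ x, ψ x ≤ (n.choose (n / 2) : ℝ) *
      ∑ f : Numbering X, ∑ x with f.IsPrefix x, ψ x := by
  subst hn
  have h : ∑ f : Numbering X, ∑ x with f.IsPrefix x, ψ x = ∑ x, #(prefixed x) * ψ x := by
    simp_rw [sum_filter]
    rw [sum_comm]
    refine sum_congr rfl fun x _ => ?_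
    rw [← sum_filter, sum_const, nsmul_eq_mul]
    rfl
  rw [h, mul_sum, mul_sum]
  refine sum_le_sum fun x _ => ?_
  rw [← card_prefixed_mul_choose x, ← mul_assoc]
  refine mul_le_mul_of_nonneg_right ?_ (hψ x)
  rw [mul_comm]
  exact_mod_cast Nat.mul_le_mul_right _ (Nat.choose_le_middle _ _)

end Numberings

/-! ### Binomial coefficients -/

theorem sixteen_pow_le (n : ℕ) : 16 ^ n ≤ 4 * (n + 1) * n.centralBinom ^ 2 := by
  -- The factor is N at index N = n + 1, because the weaker factor N + 1 would not survive the
  -- induction. The step needs 4N(N + 1) ≤ (2N + 1)².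
  have key (n : ℕ) : 16 ^ (n + 1) ≤ 4 * (n + 1) * (n + 1).centralBinom ^ 2 := by
    induction n with
    | zero => decide
    | succ n ih =>
      have h := Nat.succ_mul_centralBinom_succ (n + 1)
      refine Nat.le_of_mul_le_mul_left (c := n + 2) ?_ (by omega)
      calc (n + 2) * 16 ^ (n + 1 + 1) = 16 * (n + 2) * 16 ^ (n + 1) := by ring
        _ ≤ 16 * (n + 2) * (4 * (n + 1) * (n + 1).centralBinom ^ 2) := by gcongr
        _ = 16 * (4 * ((n + 2) * (n + 1))) * (n + 1).centralBinom ^ 2 := by ring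
        _ ≤ 16 * (2 * (n + 1) + 1) ^ 2 * (n + 1).centralBinom ^ 2 := by
          gcongr
          nlinarith
        _ = 4 * (2 * (2 * (n + 1) + 1) * (n + 1).centralBinom) ^ 2 := by ring
        _ = 4 * ((n + 1 + 1) * (n + 1 + 1).centralBinom) ^ 2 := by rw [h]
        _ = _ := by ring
  rcases n with _ | n
  · decide
  · exact (key n).trans (by gcongr; omega)

theorem four_pow_le_mul_choose_sq (n : ℕ) : 4 ^ n ≤ 16 * (n + 1) * (n.choose (n / 2)) ^ 2 := by
  obtain ⟨j, rfl | rfl⟩ := Nat.even_or_odd' n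
  · have h := sixteen_pow_le j
    rw [Nat.mul_div_cancel_left _ two_pos, pow_mul]
    rw [Nat.centralBinom] at h
    norm_num
    refine h.trans ?_
    gcongr <;> omega
  · have h := sixteen_pow_le j
    rw [show (2 * j + 1) / 2 = j by omega, pow_succ, pow_mul]
    have h2 : j.centralBinom ≤ (2 * j + 1).choose j := by
      rw [Nat.centralBinom]
      exact Nat.choose_le_choose j (by omega)
    norm_num
    calc 16 ^ j * 4 ≤ 4 * (j + 1) * j.centralBinom ^ 2 * 4 := by gcongr
      _ = 16 * (j + 1) * j.centralBinom ^ 2 := by ring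
      _ ≤ _ := by gcongr; omega

theorem two_pow_le_mul_choose (n : ℕ) :
    (2 : ℝ) ^ n ≤ 4 * √(n + 1) * (n.choose (n / 2) : ℝ) := by
  have h : ((4 : ℝ) ^ n) ≤ 16 * (n + 1) * (n.choose (n / 2) : ℝ) ^ 2 := by
    exact_mod_cast four_pow_le_mul_choose_sq n
  refine le_of_sq_le_sq ?_ (by positivity)
  rw [mul_pow, mul_pow, Real.sq_sqrt (by positivity), ← pow_mul, mul_comm n 2, pow_mul]
  norm_num
  exact h

theorem tendsto_choose_div_choose_middle (a : ℕ) :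
    Tendsto (fun n : ℕ => (n.choose (n / 2 + a) : ℝ) / n.choose (n / 2)) atTop (𝓝 1) := by
  induction a with
  | zero =>
    refine tendsto_const_nhds.congr fun n => ?_
    have : (n.choose (n / 2) : ℝ) ≠ 0 := by
      exact_mod_cast (Nat.choose_pos (Nat.div_le_self n 2)).ne'
    rw [add_zero, div_self this]
  | succ a ih =>
    have h : Tendsto (fun n : ℕ => ((n - (n / 2 + a) : ℕ) : ℝ) / ((n / 2 + a + 1 : ℕ) : ℝ)) atTop
        (𝓝 1) := by
      have hd : Tendsto (fun n : ℕ => (n / 2 + a + 1 : ℕ)) atTop atTop := by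
        refine tendsto_atTop_mono (fun n => ?_) (Nat.tendsto_div_const_atTop two_ne_zero)
        omega
      have h0 : Tendsto (fun n : ℕ => (2 * a + 2 : ℝ) / ((n / 2 + a + 1 : ℕ) : ℝ)) atTop (𝓝 0) :=
        tendsto_const_nhds.div_atTop (tendsto_natCast_atTop_atTop.comp hd)
      rw [tendsto_iff_dist_tendsto_zero]
      refine squeeze_zero' (.of_forall fun _ => dist_nonneg) ?_ h0
      filter_upwards [eventually_ge_atTop (2 * a)] with n hn
      have hpos : (0 : ℝ) < ((n / 2 + a + 1 : ℕ) : ℝ) := by positivity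
      rw [Real.dist_eq, div_sub_one hpos.ne', abs_div, abs_of_pos hpos]
      refine div_le_div_of_nonneg_right ?_ hpos.le
      have h1 : n / 2 + a + 1 ≤ (n - (n / 2 + a)) + (2 * a + 2) := by omega
      have h2 : (n - (n / 2 + a)) ≤ n / 2 + a + 1 + (2 * a + 2) := by omega
      rw [abs_le]
      have h1' : ((n / 2 + a + 1 : ℕ) : ℝ) ≤ ((n - (n / 2 + a) : ℕ) : ℝ) + (2 * a + 2) := by
        exact_mod_cast h1
      have h2' : ((n - (n / 2 + a) : ℕ) : ℝ) ≤ ((n / 2 + a + 1 : ℕ) : ℝ) + (2 * a + 2) := by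
        exact_mod_cast h2
      constructor <;> linarith
    have h2 := ih.mul h
    rw [one_mul] at h2
    refine h2.congr fun n => ?_
    have h3 : (n.choose (n / 2 + a + 1) : ℝ) * ((n / 2 + a + 1 : ℕ) : ℝ) =
        n.choose (n / 2 + a) * ((n - (n / 2 + a) : ℕ) : ℝ) := by
      exact_mod_cast Nat.choose_succ_right_eq n (n / 2 + a)
    rw [_root_.div_mul_div_comm, ← h3, mul_div_mul_right _ _ (by positivity)]
    rfl

/-! ### Weighted graph containers -/

open Classical in
/-- If the family `F` of objects `c`, each with an independent set `I c` of a graph, has a weight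
bound for all sets of maximum degree at most `d`, then it has one for all sets of vertices. -/
theorem sum_le_of_maxDegree_bound {ι V : Type*} [DecidableEq V] (F : Finset ι) (I : ι → Finset V)
    (w : ι → ℝ) (adj : V → V → Prop) (hirr : ∀ v, ¬ adj v v)
    (hind : ∀ c ∈ F, ∀ u ∈ I c, ∀ v ∈ I c, ¬ adj u v) {d : ℕ} {M l E : ℝ} (hM : 1 ≤ M)
    (hl : 1 ≤ l) (hlM : l ^ d + M ≤ l ^ (d + 1)) (hw : ∀ c ∈ F, 0 ≤ w c) (hE0 : 0 ≤ E)
    (A₀ : Finset V)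
    (hE : ∀ B ⊆ A₀, (∀ v ∈ B, #{u ∈ B | adj v u} ≤ d) → ∀ S : Finset V,
      ∑ c ∈ F with I c ⊆ B ∪ S, w c ≤ E * M ^ #S) :
    ∀ A ⊆ A₀, ∀ S : Finset V, ∑ c ∈ F with I c ⊆ A ∪ S, w c ≤ E * M ^ #S * l ^ #A := by
  intro A
  induction A using Finset.strongInduction with
  | H A ih =>
  intro hA S
  have hES : 0 ≤ E * M ^ #S := by positivity
  by_cases hdeg : ∀ v ∈ A, #{u ∈ A | adj v u} ≤ d
  · exact (hE A hA hdeg S).trans (le_mul_of_one_le_right hES (one_le_pow₀ hl))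
  push Not at hdeg
  obtain ⟨v, hvA, hv⟩ := hdeg
  set A₁ := A.erase v with hA₁
  set A₂ := A₁.filter (fun u => ¬ adj v u) with hA₂
  have h1 : A₁ ⊂ A := erase_ssubset hvA
  have h2 : A₂ ⊂ A := (filter_subset _ _).trans_ssubset h1
  have hc1 : #A₁ + 1 = #A := card_erase_add_one hvA
  have hc2 : #A₂ + (d + 1) ≤ #A := by
    have h3 : #{u ∈ A₁ | adj v u} + #A₂ = #A₁ := card_filter_add_card_filter_not _
    have h4 : ({u ∈ A₁ | adj v u} : Finset V) = {u ∈ A | adj v u} := by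
      ext u
      simp only [hA₁, mem_filter, mem_erase]
      refine ⟨fun h => ⟨h.1.2, h.2⟩, fun h => ⟨⟨?_, h.1⟩, h.2⟩⟩
      rintro rfl
      exact hirr _ h.2
    rw [h4] at h3
    omega
  -- Branch on v: either v is not in I c and A loses v, or v is in I c, is moved to S at cost M, and
  -- A loses more than d neighbours. The hypothesis `hlM` is what closes this recursion.
  have hsub : (F.filter fun c => I c ⊆ A ∪ S) ⊆
      (F.filter fun c => I c ⊆ A₁ ∪ S) ∪ F.filter fun c => I c ⊆ A₂ ∪ insert v S := by
    intro c hc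
    rw [mem_filter] at hc
    rw [mem_union, mem_filter, mem_filter]
    by_cases hvc : v ∈ I c
    · refine Or.inr ⟨hc.1, fun u hu => ?_⟩
      have := hind c hc.1 v hvc u hu
      have := hc.2 hu
      by_cases huv : u = v <;> simp_all
    · refine Or.inl ⟨hc.1, fun u hu => ?_⟩
      have := hc.2 hu
      have : u ≠ v := fun h => hvc (h ▸ hu)
      simp_all
  have hl0 : (0 : ℝ) ≤ l := by linarith
  calc ∑ c ∈ F with I c ⊆ A ∪ S, w c
      ≤ ∑ c ∈ (F.filter fun c => I c ⊆ A₁ ∪ S) ∪ F.filter fun c => I c ⊆ A₂ ∪ insert v S, w c := by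
        refine sum_le_sum_of_subset_of_nonneg hsub fun c hc _ => hw c ?_
        rw [mem_union, mem_filter, mem_filter] at hc
        tauto
    _ ≤ (∑ c ∈ F with I c ⊆ A₁ ∪ S, w c) + ∑ c ∈ F with I c ⊆ A₂ ∪ insert v S, w c := by
        rw [← sum_union_inter]
        refine le_add_of_nonneg_right (sum_nonneg fun c hc => hw c ?_)
        rw [mem_inter, mem_filter] at hc
        exact hc.1.1
    _ ≤ E * M ^ #S * l ^ #A₁ + E * M ^ #(insert v S) * l ^ #A₂ :=
        add_le_add (ih _ h1 (h1.subset.trans hA) S) (ih _ h2 (h2.subset.trans hA) _)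
    _ ≤ E * M ^ #S * l ^ (#A - (d + 1) + d) + E * M ^ (#S + 1) * l ^ (#A - (d + 1)) := by
        gcongr ?_ + E * ?_ * ?_
        · rw [show #A - (d + 1) + d = #A₁ by omega]
        · exact pow_le_pow_right₀ hM (card_insert_le _ _)
        · exact pow_le_pow_right₀ hl (by omega)
    _ = E * M ^ #S * l ^ (#A - (d + 1)) * (l ^ d + M) := by ring
    _ ≤ E * M ^ #S * l ^ (#A - (d + 1)) * l ^ (d + 1) := by gcongr
    _ = E * M ^ #S * l ^ #A := by
        rw [mul_assoc, ← pow_add, Nat.sub_add_cancel (by omega)]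

variable {m n : ℕ}

/-! ### Reduction of forbidden chains to forbidden pairs -/

theorem Template.valid_iff {G : Set (List (Fin m))} {T : Template m n} :
    T.Valid G ↔ ∀ g ∈ G, ∀ x : Fin g.length → Cube n, StrictMono x → ∃ j, g.get j ∉ T (x j) := by
  classical
  constructor
  · intro hT g hg x hx
    by_contra! hc
    -- Color the given chain by g and the rest of the support arbitrarily.
    let c : ColoredSubset m n := fun y =>
      if h : ∃ j, x j = y then some (g.get h.choose)
      else if h : (T y).Nonempty then some h.choose else none
    have hcx (j) : c (x j) = some (g.get j) := by
      have h : ∃ i, x i = x j := ⟨j, rfl⟩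
      simp only [c, dif_pos h]
      rw [hx.injective h.choose_spec]
    refine hT c ⟨fun y hy => ?_, fun y hy => ?_⟩ g hg ⟨x, hx, hcx⟩
    · by_cases h : ∃ j, x j = y
      · obtain ⟨j, rfl⟩ := h
        exact ⟨_, hc j, hcx j⟩
      · have h' : (T y).Nonempty := nonempty_iff_ne_empty.2 hy
        exact ⟨h'.choose, h'.choose_spec, by simp only [c, dif_neg h, dif_pos h']⟩
    · have hy' : T y = ∅ := by simpa [Template.supp] using hy
      have h : ¬ ∃ j, x j = y := by
        rintro ⟨j, rfl⟩
        have := hc j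
        simp [hy'] at this
      simp only [c, dif_neg h, hy', Finset.not_nonempty_empty, dite_false]
  · rintro h c ⟨hc1, hc2⟩ g hg ⟨x, hx, hxc⟩
    obtain ⟨j, hj⟩ := h g hg x hx
    by_cases hs : x j ∈ T.supp
    · obtain ⟨i, hi, hci⟩ := hc1 _ hs
      rw [hxc j, Option.some_inj] at hci
      exact hj (hci ▸ hi)
    · have := hc2 _ hs
      rw [hxc j] at this
      cases this

/-- The word `p` is the word of colors of some increasing chain with least element `x`. -/
def Starts (c : ColoredSubset m n) (p : List (Fin m)) (x : Cube n) : Prop :=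
  ∃ f : Fin p.length → Cube n, StrictMono f ∧ (∀ j, c (f j) = some (p.get j)) ∧
    ∃ h : 0 < p.length, f ⟨0, h⟩ = x

theorem starts_singleton {c : ColoredSubset m n} {x : Cube n} {i : Fin m} (h : c x = some i) :
    Starts c [i] x := by
  refine ⟨fun _ => x, fun a b hab => ?_, fun j => ?_, by simp, rfl⟩
  · have ha := a.2
    have hb := b.2
    simp only [List.length_singleton] at ha hb
    rw [Fin.lt_def] at hab
    omega
  · have : j = ⟨0, by simp⟩ := Subsingleton.elim (α := Fin 1) _ _
    subst this
    simpa using h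

theorem Starts.cons {c : ColoredSubset m n} {x y : Cube n} {i : Fin m} {p : List (Fin m)}
    (h : c x = some i) (hxy : x < y) (hp : Starts c p y) : Starts c (i :: p) x := by
  obtain ⟨f, hf, hfc, h0, hfy⟩ := hp
  refine ⟨Fin.cons x f, ?_, ?_, by simp, rfl⟩
  · refine (Fin.strictMono_cons (f := f)).2 ⟨fun j => ?_, hf⟩
    refine hxy.trans_le ?_
    rw [← hfy]
    exact hf.monotone (Fin.mk_le_of_le_val (Nat.zero_le _))
  · intro j
    refine Fin.cases ?_ (fun j => ?_) j
    · simpa using h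
    · simpa using hfc j

/-- The words of length at most `k`. -/
noncomputable def words (m k : ℕ) : Finset (List (Fin m)) :=
  (List.finite_length_le (Fin m) k).toFinset

theorem mem_words {k : ℕ} {p : List (Fin m)} : p ∈ words m k ↔ p.length ≤ k := by
  simp [words]

/-- A refined color consists of a color and of a set of words. It stands for an element `x` of a
colored subset, and the words of colors of the chains which start at `x`. -/
abbrev RefinedColor (m : ℕ) : Type := Fin m × Finset (List (Fin m))

/-- The refined colors `q`, `r` cannot be those of some elements `x < y`. -/
def Conflict (k : ℕ) (q r : RefinedColor m) : Prop :=
  ∃ p ∈ r.2, p.length < k ∧ q.1 :: p ∉ q.2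

open Classical in
/-- The refined colors which may occur in a valid colored subset. -/
noncomputable def admissible (G : Set (List (Fin m))) (k : ℕ) : Finset (RefinedColor m) :=
  {q ∈ univ ×ˢ (words m k).powerset | [q.1] ∈ q.2 ∧ ∀ g ∈ G, g ∉ q.2}

theorem mem_admissible {G : Set (List (Fin m))} {k : ℕ} {q : RefinedColor m} :
    q ∈ admissible G k ↔ q.2 ⊆ words m k ∧ [q.1] ∈ q.2 ∧ ∀ g ∈ G, g ∉ q.2 := by
  simp [admissible]

/-- Without a self-conflict, q.2 would be closed under prepending the color of q, as long as the
length stays at most k. Starting from the one-letter word it would reach the forbidden monochromatic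
word. -/
theorem conflict_self {G : Set (List (Fin m))} {k : ℕ}
    (hG : ∀ g ∈ G, 2 ≤ g.length ∧ g.length ≤ k) (hsparse : IsSparse G) {q : RefinedColor m}
    (hq : q ∈ admissible G k) : Conflict k q q := by
  obtain ⟨-, h1, h2⟩ := mem_admissible.1 hq
  obtain ⟨l, hl⟩ := hsparse q.1
  have hlk := hG _ hl
  rw [List.length_replicate] at hlk
  by_contra hc
  have key (j : ℕ) : j + 1 ≤ k → List.replicate (j + 1) q.1 ∈ q.2 := by
    induction j with
    | zero => exact fun _ => h1
    | succ j ih =>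
      intro hj
      by_contra h
      exact hc ⟨_, ih (by omega), by simp; omega, by rwa [← List.replicate_succ]⟩
  refine h2 _ hl ?_
  have := key (l - 1) (by omega)
  rwa [Nat.sub_add_cancel (by omega)] at this

/-- Induction from the top of the chain: the tail of g lies in the second set, so absence of a
conflict puts g in the first. Only neighbouring positions are used. -/
theorem mem_of_not_conflict {k : ℕ} : ∀ (g : List (Fin m))
    (s : Fin g.length → Finset (List (Fin m))) (h0 : 0 < g.length), g.length ≤ k → (∀ j, [g.get j] ∈ s j) →
    (∀ i j, i < j → ¬ Conflict k (g.get i, s i) (g.get j, s j)) → g ∈ s ⟨0, h0⟩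
  | [], _, h0, _, _, _ => by simp at h0
  | [i], s, _, _, h1, _ => h1 ⟨0, by simp⟩
  | i :: j :: p, s, h0, hk, h1, hc => by
    have ih := mem_of_not_conflict (k := k) (j :: p) (fun a => s a.succ) (by simp)
      (by simp only [List.length_cons] at hk ⊢; omega)
      (fun a => h1 a.succ) (fun a b hab => hc a.succ b.succ (Fin.succ_lt_succ_iff.2 hab))
    by_contra h
    refine hc ⟨0, h0⟩ ⟨1, by simp⟩ (by simp) ⟨j :: p, ih, ?_, h⟩
    simp only [List.length_cons] at hk ⊢
    omega

/-- The vertices `(x, q)`, `(y, r)` cannot both occur in a valid colored subset. -/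
def Adj (k : ℕ) (u v : Cube n × RefinedColor m) : Prop :=
  (u.1 < v.1 ∧ Conflict k u.2 v.2) ∨ (v.1 < u.1 ∧ Conflict k v.2 u.2)

theorem not_adj_self (k : ℕ) (v : Cube n × RefinedColor m) : ¬ Adj k v v := by
  simp [Adj]

open Classical in
/-- The words of length at most `k` which start at `x`. -/
noncomputable def startWords (k : ℕ) (c : ColoredSubset m n) (x : Cube n) :
    Finset (List (Fin m)) :=
  {p ∈ words m k | Starts c p x}

theorem mem_startWords {k : ℕ} {c : ColoredSubset m n} {x : Cube n} {p : List (Fin m)} :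
    p ∈ startWords k c x ↔ p.length ≤ k ∧ Starts c p x := by
  simp [startWords, mem_words]

theorem startWords_subset {k : ℕ} {c : ColoredSubset m n} {x : Cube n} :
    startWords k c x ⊆ words m k :=
  fun _ hp => mem_words.2 (mem_startWords.1 hp).1

open Classical in
/-- The elements of a colored subset with their refined colors. -/
noncomputable def refinement (k : ℕ) (c : ColoredSubset m n) : Finset (Cube n × RefinedColor m) :=
  {v ∈ univ ×ˢ (univ ×ˢ (words m k).powerset) | c v.1 = some v.2.1 ∧ v.2.2 = startWords k c v.1}

theorem mem_refinement {k : ℕ} {c : ColoredSubset m n} {v : Cube n × RefinedColor m} :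
    v ∈ refinement k c ↔ c v.1 = some v.2.1 ∧ v.2.2 = startWords k c v.1 := by
  simp only [refinement, mem_filter, mem_product, mem_univ, true_and, mem_powerset,
    and_iff_right_iff_imp]
  rintro ⟨-, h⟩
  rw [h]
  exact startWords_subset

theorem not_conflict_of_mem_refinement {k : ℕ} {c : ColoredSubset m n}
    {u v : Cube n × RefinedColor m} (hu : u ∈ refinement k c) (hv : v ∈ refinement k c)
    (huv : u.1 < v.1) : ¬ Conflict k u.2 v.2 := by
  rw [mem_refinement] at hu hv
  rintro ⟨p, hp, hpk, hup⟩
  rw [hv.2, mem_startWords] at hp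
  refine hup ?_
  rw [hu.2, mem_startWords]
  exact ⟨by simpa using hpk, hp.2.cons hu.1 huv⟩

theorem not_adj_of_mem_refinement {k : ℕ} {c : ColoredSubset m n}
    {u v : Cube n × RefinedColor m} (hu : u ∈ refinement k c) (hv : v ∈ refinement k c) :
    ¬ Adj k u v := by
  rintro (⟨h, h'⟩ | ⟨h, h'⟩)
  · exact not_conflict_of_mem_refinement hu hv h h'
  · exact not_conflict_of_mem_refinement hv hu h h'

theorem mem_admissible_of_mem_refinement {G : Set (List (Fin m))} {k : ℕ} {c : ColoredSubset m n}
    (hk : 1 ≤ k) (hc : IsValid G c) {v : Cube n × RefinedColor m} (hv : v ∈ refinement k c) :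
    v.2 ∈ admissible G k := by
  rw [mem_refinement] at hv
  rw [mem_admissible, hv.2]
  refine ⟨startWords_subset, mem_startWords.2 ⟨by simpa using hk, starts_singleton hv.1⟩,
    fun g hg hgs => ?_⟩
  obtain ⟨f, hf, hfc, -⟩ := (mem_startWords.1 hgs).2
  exact hc g hg ⟨f, hf, hfc⟩

/-- The template of the colors which occur at a set of vertices. -/
def colorsOf (B : Finset (Cube n × RefinedColor m)) : Template m n :=
  fun x => {v ∈ B | v.1 = x}.image fun v => v.2.1

theorem mem_colorsOf {B : Finset (Cube n × RefinedColor m)} {x : Cube n} {i : Fin m} :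
    i ∈ colorsOf B x ↔ ∃ s, (x, i, s) ∈ B := by
  simp only [colorsOf, mem_image, mem_filter]
  constructor
  · rintro ⟨⟨y, j, s⟩, ⟨h, rfl⟩, rfl⟩
    exact ⟨s, h⟩
  · rintro ⟨s, h⟩
    exact ⟨_, ⟨h, rfl⟩, rfl⟩

theorem valid_colorsOf {G : Set (List (Fin m))} {k : ℕ}
    (hG : ∀ g ∈ G, 2 ≤ g.length ∧ g.length ≤ k) {B : Finset (Cube n × RefinedColor m)}
    (hB : ∀ v ∈ B, v.2 ∈ admissible G k)
    (hc : ∀ u ∈ B, ∀ v ∈ B, u.1 < v.1 → ¬ Conflict k u.2 v.2) : (colorsOf B).Valid G := by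
  rw [Template.valid_iff]
  intro g hg x hx
  by_contra! h
  simp_rw [mem_colorsOf] at h
  choose s hs using h
  have h0 : 0 < g.length := by
    have := hG g hg
    omega
  refine (mem_admissible.1 (hB _ (hs ⟨0, h0⟩))).2.2 g hg
    (mem_of_not_conflict g s h0 (hG g hg).2 (fun j => ?_) fun i j hij => ?_)
  · exact (mem_admissible.1 (hB _ (hs j))).2.1
  · exact hc _ (hs i) _ (hs j) (hx hij)

/-! ### The critical exponent is attained -/

theorem lt_of_isChain_of_card_lt {A : Set (Cube n)} (hA : IsChain (· ⊆ ·) A) {x y : Cube n}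
    (hx : x ∈ A) (hy : y ∈ A) (hxy : #x < #y) : x < y := by
  have hne : x ≠ y := by
    rintro rfl
    exact lt_irrefl _ hxy
  rcases hA hx hy hne with h | h
  · exact lt_of_le_of_ne h hne
  · exact absurd (card_le_card h) (by omega)

theorem injOn_card_of_isChain {A : Set (Cube n)} (hA : IsChain (· ⊆ ·) A) :
    Set.InjOn (fun x : Cube n => #x) A := by
  intro x hx y hy hxy
  by_contra hne
  rcases hA hx hy hne with h | h
  · exact hne (eq_of_subset_of_card_le h hxy.ge)
  · exact hne (eq_of_subset_of_card_le h hxy.le).symm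

/-- More than k occurrences of one color on a chain would contain a forbidden monochromatic chain.
-/
theorem card_support_le {k : ℕ} {G : Set (List (Fin m))}
    (hG : ∀ g ∈ G, 2 ≤ g.length ∧ g.length ≤ k) (hsparse : IsSparse G) {T : Template m n}
    (hT : T.Valid G) {A : Set (Cube n)} (hA : IsChain (· ⊆ ·) A) (hTA : T.SupportedOn A) :
    #{x | T x ≠ ∅} ≤ m * k := by
  classical
  have hcolor (i : Fin m) : #{x | i ∈ T x} ≤ k := by
    by_contra! hlt
    obtain ⟨l, hl⟩ := hsparse i
    set D : Finset (Cube n) := {x | i ∈ T x} with hD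
    have hDA : ∀ x ∈ D, x ∈ A := by
      intro x hx
      by_contra h
      rw [hD, mem_filter, hTA x h] at hx
      simp at hx
    have hcard : #(D.image fun x => #x) = #D :=
      card_image_of_injOn ((injOn_card_of_isChain hA).mono hDA)
    have hle : (List.replicate l i).length ≤ #(D.image fun x => #x) := by
      rw [hcard]
      exact (hG _ hl).2.trans hlt.le
    have hmem := fun j => mem_image.1 (orderEmbOfCardLe_mem _ hle j)
    choose x hx hxc using hmem
    obtain ⟨j, hj⟩ := Template.valid_iff.1 hT _ hl x fun a b hab =>
      lt_of_isChain_of_card_lt hA (hDA _ (hx a)) (hDA _ (hx b))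
        (by rw [hxc, hxc]; exact (orderEmbOfCardLe _ hle).strictMono hab)
    refine hj ?_
    rw [List.get_eq_getElem, List.getElem_replicate]
    exact (mem_filter.1 (hx j)).2
  calc #{x | T x ≠ ∅} ≤ #((univ : Finset (Fin m)).biUnion fun i => {x | i ∈ T x}) := by
        refine card_le_card fun x hx => ?_
        obtain ⟨i, hi⟩ := nonempty_iff_ne_empty.2 (mem_filter.1 hx).2
        exact mem_biUnion.2 ⟨i, mem_univ _, by simpa using hi⟩
    _ ≤ #(univ : Finset (Fin m)) * k := card_biUnion_le_card_mul _ _ _ fun i _ => hcolor i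
    _ = m * k := by simp

/-- The entropy depends only on the list of nonempty values of T, and these lists have bounded
length over a finite alphabet, whatever n is. -/
theorem finite_chainEntropies {k : ℕ} {G : Set (List (Fin m))}
    (hG : ∀ g ∈ G, 2 ≤ g.length ∧ g.length ≤ k) (hsparse : IsSparse G) (β : Fin m → ℝ) :
    (chainEntropies G β).Finite := by
  classical
  refine ((List.finite_length_le (Finset (Fin m)) (m * k)).image
    fun l => (l.map fun s => Real.log (1 + ∑ i ∈ s, β i)).sum).subset ?_
  rintro _ ⟨n, T, hT, ⟨A, hA, hTA⟩, rfl⟩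
  refine ⟨(({x | T x ≠ ∅} : Finset (Cube n)).toList).map T, ?_, ?_⟩
  · simpa using card_support_le hG hsparse hT hA hTA
  · dsimp only
    rw [List.map_map, Finset.sum_map_toList, Template.entropy]
    refine sum_subset (subset_univ _) fun x _ hx => ?_
    have : T x = ∅ := by simpa using hx
    simp [this]

theorem zero_mem_chainEntropies {k : ℕ} {G : Set (List (Fin m))}
    (hG : ∀ g ∈ G, 2 ≤ g.length ∧ g.length ≤ k) (β : Fin m → ℝ) : 0 ∈ chainEntropies G β := by
  refine ⟨0, fun _ => ∅, Template.valid_iff.2 fun g hg x hx => ?_,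
    ⟨∅, Set.pairwise_empty _, fun _ _ => rfl⟩, by simp [Template.entropy]⟩
  exact ⟨⟨0, by have := hG g hg; omega⟩, by simp⟩

theorem isGreatest_omegaCrit {k : ℕ} {G : Set (List (Fin m))}
    (hG : ∀ g ∈ G, 2 ≤ g.length ∧ g.length ≤ k) (hsparse : IsSparse G) (β : Fin m → ℝ) :
    IsGreatest (chainEntropies G β) (omegaCrit G β) :=
  have hfin := finite_chainEntropies hG hsparse β
  ⟨Set.Nonempty.csSup_mem ⟨0, zero_mem_chainEntropies hG β⟩ hfin,
    fun _ hw => le_csSup hfin.bddAbove hw⟩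

theorem omegaCrit_pos {k : ℕ} {G : Set (List (Fin m))}
    (hG : ∀ g ∈ G, 2 ≤ g.length ∧ g.length ≤ k) (hsparse : IsSparse G) {β : Fin m → ℝ}
    (hβ : ∀ i, 0 < β i) (i : Fin m) : 0 < omegaCrit G β := by
  have hmem : Real.log (1 + β i) ∈ chainEntropies G β := by
    refine ⟨0, fun _ => {i}, Template.valid_iff.2 fun g hg x hx => ?_,
      ⟨Set.univ, Set.subsingleton_of_subsingleton.pairwise _,
        fun x hx => absurd (Set.mem_univ x) hx⟩, ?_⟩
    · have := hG g hg
      have h01 : (⟨0, by omega⟩ : Fin g.length) < ⟨1, by omega⟩ := by simp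
      exact absurd (Subsingleton.elim _ _) (hx h01).ne
    · simp [Template.entropy]
  exact (Real.log_pos (by linarith [hβ i])).trans_le ((isGreatest_omegaCrit hG hsparse β).2 hmem)

/-! ### Sets of vertices of small degree have small entropy -/

-- On a chain, each refined color has at most one minimal vertex. Any other vertex lies above one of
-- the same refined color, with which it conflicts.
open Classical in
theorem card_le_card_admissible_add {k : ℕ} {G : Set (List (Fin m))}
    (hG : ∀ g ∈ G, 2 ≤ g.length ∧ g.length ≤ k) (hsparse : IsSparse G)
    {B : Finset (Cube n × RefinedColor m)} (hB : ∀ v ∈ B, v.2 ∈ admissible G k)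
    (hchain : IsChain (· ⊆ ·) (Prod.fst '' (B : Set (Cube n × RefinedColor m)))) :
    #B ≤ #(admissible G k) + #{e ∈ B ×ˢ B | e.1.1 < e.2.1 ∧ Conflict k e.1.2 e.2.2} := by
  rw [← card_filter_add_card_filter_not (s := B) fun v => ∀ u ∈ B, u.2 = v.2 → ¬ u.1 < v.1]
  refine add_le_add ?_ ?_
  · refine card_le_card_of_injOn Prod.snd (fun v hv => hB v (mem_filter.1 hv).1) ?_
    intro u hu v hv huv
    have hu' := mem_filter.1 hu
    have hv' := mem_filter.1 hv
    refine Prod.ext ?_ huv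
    by_contra hne
    rcases hchain ⟨u, hu'.1, rfl⟩ ⟨v, hv'.1, rfl⟩ hne with h | h
    · exact hv'.2 u hu'.1 huv (lt_of_le_of_ne h hne)
    · exact hu'.2 v hv'.1 huv.symm (lt_of_le_of_ne h (Ne.symm hne))
  · refine le_trans (card_le_card ?_) (card_image_le (f := Prod.snd))
    intro v hv
    rw [mem_filter] at hv
    obtain ⟨hvB, hv⟩ := hv
    push Not at hv
    obtain ⟨u, huB, huv, hlt⟩ := hv
    refine mem_image.2 ⟨(u, v), mem_filter.2 ⟨mem_product.2 ⟨huB, hvB⟩, hlt, ?_⟩, rfl⟩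
    dsimp only
    rw [huv]
    exact conflict_self hG hsparse (hB v hvB)

theorem entropy_colorsOf_union_le {β : Fin m → ℝ} (hβ : ∀ i, 0 < β i) {L : ℝ}
    (hL : ∀ s : Finset (Fin m), Real.log (1 + ∑ i ∈ s, β i) ≤ L)
    (B S : Finset (Cube n × RefinedColor m)) :
    (colorsOf (B ∪ S)).entropy β ≤ (colorsOf B).entropy β + L * #S := by
  have hL0 : 0 ≤ L := by simpa using hL ∅
  have hcard : (#S : ℝ) = ∑ x : Cube n, (#{v ∈ S | v.1 = x} : ℝ) := by
    exact_mod_cast card_eq_sum_card_fiberwise (f := Prod.fst) (t := univ) fun _ _ => mem_univ _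
  rw [hcard, mul_sum, Template.entropy, Template.entropy, ← sum_add_distrib]
  refine sum_le_sum fun x _ => ?_
  rcases ({v ∈ S | v.1 = x} : Finset _).eq_empty_or_nonempty with h | h
  · simp [colorsOf, filter_union, h]
  · have h0 : 0 ≤ Real.log (1 + ∑ i ∈ colorsOf B x, β i) :=
      Real.log_nonneg (le_add_of_nonneg_right (sum_nonneg fun i _ => (hβ i).le))
    have h1 : (1 : ℝ) ≤ #{v ∈ S | v.1 = x} := by exact_mod_cast h.card_pos
    exact (hL _).trans (by nlinarith)

theorem entropy_colorsOf_le_mul_card {β : Fin m → ℝ} (hβ : ∀ i, 0 < β i) {L : ℝ}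
    (hL : ∀ s : Finset (Fin m), Real.log (1 + ∑ i ∈ s, β i) ≤ L)
    (B : Finset (Cube n × RefinedColor m)) : (colorsOf B).entropy β ≤ L * #B := by
  simpa [colorsOf, Template.entropy] using entropy_colorsOf_union_le hβ hL ∅ B

-- With no conflict, `colorsOf B` is a valid template on a chain. With b ≥ 1 conflicts, the crude
-- bound L * #B suffices, since #B ≤ K + b ≤ (K + 1) * b for K admissible refined colors.
open Classical in
theorem entropy_colorsOf_chain_le {k : ℕ} {G : Set (List (Fin m))}
    (hG : ∀ g ∈ G, 2 ≤ g.length ∧ g.length ≤ k) (hsparse : IsSparse G) {β : Fin m → ℝ}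
    (hβ : ∀ i, 0 < β i) {L : ℝ} (hL : ∀ s : Finset (Fin m), Real.log (1 + ∑ i ∈ s, β i) ≤ L)
    {B : Finset (Cube n × RefinedColor m)} (hB : ∀ v ∈ B, v.2 ∈ admissible G k)
    (hchain : IsChain (· ⊆ ·) (Prod.fst '' (B : Set (Cube n × RefinedColor m)))) :
    (colorsOf B).entropy β ≤ omegaCrit G β + L * (#(admissible G k) + 1) *
      #{e ∈ B ×ˢ B | e.1.1 < e.2.1 ∧ Conflict k e.1.2 e.2.2} := by
  have hL0 : 0 ≤ L := by simpa using hL ∅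
  have hmax := (isGreatest_omegaCrit hG hsparse β).2
  rcases Nat.eq_zero_or_pos #{e ∈ B ×ˢ B | e.1.1 < e.2.1 ∧ Conflict k e.1.2 e.2.2} with h | h
  · rw [h, Nat.cast_zero, mul_zero, add_zero]
    rw [card_eq_zero, filter_eq_empty_iff] at h
    refine hmax ⟨n, colorsOf B, valid_colorsOf hG hB fun u hu v hv huv hc => ?_,
      ⟨_, hchain, fun x hx => ?_⟩, rfl⟩
    · exact h (mem_product.2 ⟨hu, hv⟩ : (u, v) ∈ B ×ˢ B) ⟨huv, hc⟩
    · refine eq_empty_of_forall_notMem fun i hi => hx ?_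
      obtain ⟨s, hs⟩ := mem_colorsOf.1 hi
      exact ⟨_, hs, rfl⟩
  · have h0 : 0 ≤ omegaCrit G β := hmax (zero_mem_chainEntropies hG β)
    have hcard := card_le_card_admissible_add hG hsparse hB hchain
    generalize #{e ∈ B ×ˢ B | e.1.1 < e.2.1 ∧ Conflict k e.1.2 e.2.2} = b at *
    have hcard' : #B ≤ (#(admissible G k) + 1) * b := by nlinarith
    calc (colorsOf B).entropy β ≤ L * #B := entropy_colorsOf_le_mul_card hβ hL B
      _ ≤ L * ((#(admissible G k) + 1) * b) := by
        gcongr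
        exact_mod_cast hcard'
      _ ≤ _ := by rw [mul_assoc]; linarith

-- Each conflict is charged to its two endpoints, and each vertex is charged at most d times.
open Classical in
theorem mul_sum_card_conflicts_le {k d : ℕ} {B : Finset (Cube n × RefinedColor m)}
    (hB0 : ∀ v ∈ B, v.1 ≠ ∅ ∧ v.1 ≠ univ) (hd : ∀ v ∈ B, #{u ∈ B | Adj k v u} ≤ d) :
    n * ∑ e ∈ B ×ˢ B with e.1.1 < e.2.1 ∧ Conflict k e.1.2 e.2.2,
        #(prefixed e.1.1 ∩ prefixed e.2.1) ≤ 2 * (d * ∑ v ∈ B, #(prefixed v.1)) := by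
  let R : Cube n × RefinedColor m → Cube n × RefinedColor m → Prop :=
    fun u v => u.1 < v.1 ∧ Conflict k u.2 v.2
  calc n * ∑ e ∈ B ×ˢ B with e.1.1 < e.2.1 ∧ Conflict k e.1.2 e.2.2,
        #(prefixed e.1.1 ∩ prefixed e.2.1)
      ≤ ∑ e ∈ B ×ˢ B with R e.1 e.2, 2 * (#(prefixed e.1.1) + #(prefixed e.2.1)) := by
        rw [mul_sum]
        refine sum_le_sum fun e he => ?_
        rw [mem_filter, mem_product] at he
        exact card_mul_card_prefixed_inter_le he.2.1 (hB0 _ he.1.1).1 (hB0 _ he.1.2).2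
          (Fintype.card_fin n)
    _ = 2 * (∑ u ∈ B, ∑ v ∈ B, (if R u v then #(prefixed u.1) else 0) +
          ∑ u ∈ B, ∑ v ∈ B, (if R u v then #(prefixed v.1) else 0)) := by
        rw [← mul_sum, sum_filter, sum_product, ← sum_add_distrib]
        congr 1
        refine sum_congr rfl fun u _ => ?_
        rw [← sum_add_distrib]
        refine sum_congr rfl fun v _ => ?_
        split_ifs <;> rfl
    _ = 2 * ∑ u ∈ B, #{v ∈ B | Adj k u v} * #(prefixed u.1) := by
        rw [sum_comm (f := fun u v => if R u v then #(prefixed v.1) else 0), ← sum_add_distrib]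
        congr 1
        refine sum_congr rfl fun u _ => ?_
        rw [← sum_add_distrib, ← smul_eq_mul, ← sum_const, sum_filter]
        refine sum_congr rfl fun v _ => ?_
        by_cases h1 : R u v
        · have h2 : ¬ R v u := fun h => lt_asymm h1.1 h.1
          rw [if_pos h1, if_neg h2, if_pos (show Adj k u v from Or.inl h1), add_zero]
        · by_cases h2 : R v u
          · rw [if_neg h1, if_pos h2, if_pos (show Adj k u v from Or.inr h2), zero_add]
          · rw [if_neg h1, if_neg h2, if_neg (show ¬ Adj k u v from not_or.2 ⟨h1, h2⟩), add_zero]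
    _ ≤ 2 * (d * ∑ v ∈ B, #(prefixed v.1)) := by
        refine Nat.mul_le_mul_left _ ?_
        rw [mul_sum]
        exact sum_le_sum fun u hu => Nat.mul_le_mul_right _ (hd u hu)

open Classical in
theorem entropy_colorsOf_le {k d : ℕ} {G : Set (List (Fin m))}
    (hG : ∀ g ∈ G, 2 ≤ g.length ∧ g.length ≤ k) (hsparse : IsSparse G) {β : Fin m → ℝ}
    (hβ : ∀ i, 0 < β i) {L : ℝ}
    (hL : ∀ s : Finset (Fin m), Real.log (1 + ∑ i ∈ s, β i) ≤ L)
    {B : Finset (Cube n × RefinedColor m)} (hB : ∀ v ∈ B, v.2 ∈ admissible G k)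
    (hB0 : ∀ v ∈ B, v.1 ≠ ∅ ∧ v.1 ≠ univ) (hd : ∀ v ∈ B, #{u ∈ B | Adj k v u} ≤ d)
    (hn : 0 < n) (hdn : 4 * d ≤ n) :
    (colorsOf B).entropy β ≤ (n.choose (n / 2) : ℝ) * (omegaCrit G β +
      L * (#(admissible G k) + 1) * (4 * #(admissible G k) * (d / n))) := by
  have hL0 : 0 ≤ L := by simpa using hL ∅
  set K := #(admissible G k) with hK
  let Bf : Numbering (Fin n) → Finset (Cube n × RefinedColor m) :=
    fun f => {v ∈ B | f.IsPrefix v.1}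
  let bad : Numbering (Fin n) → ℕ :=
    fun f => #{e ∈ Bf f ×ˢ Bf f | e.1.1 < e.2.1 ∧ Conflict k e.1.2 e.2.2}
  have hBf (f) : ∀ v ∈ Bf f, v.2 ∈ admissible G k := fun v hv => hB v (mem_filter.1 hv).1
  have hch (f) : IsChain (· ⊆ ·) (Prod.fst '' (Bf f : Set (Cube n × RefinedColor m))) := by
    refine (isChain_isPrefix f).mono ?_
    rintro _ ⟨v, hv, rfl⟩
    exact (mem_filter.1 hv).2
  have hbadsum : ∑ f, bad f = ∑ e ∈ B ×ˢ B with e.1.1 < e.2.1 ∧ Conflict k e.1.2 e.2.2,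
      #(prefixed e.1.1 ∩ prefixed e.2.1) := by
    have h (f) : bad f = ∑ e ∈ B ×ˢ B with e.1.1 < e.2.1 ∧ Conflict k e.1.2 e.2.2,
        if f ∈ prefixed e.1.1 ∩ prefixed e.2.1 then 1 else 0 := by
      rw [← sum_filter, ← card_eq_sum_ones]
      refine congrArg card ?_
      ext e
      simp only [Bf, mem_filter, mem_product, mem_inter, mem_prefixed]
      tauto
    simp_rw [h]
    rw [sum_comm]
    refine sum_congr rfl fun e _ => ?_
    rw [← sum_filter, ← card_eq_sum_ones, filter_mem_eq_inter, univ_inter]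
  have hcardsum : ∑ f, #(Bf f) = ∑ v ∈ B, #(prefixed v.1) := by
    have h (f) : #(Bf f) = ∑ v ∈ B, if f ∈ prefixed v.1 then 1 else 0 := by
      rw [← sum_filter, ← card_eq_sum_ones]
      simp only [Bf, mem_prefixed]
    simp_rw [h]
    rw [sum_comm]
    refine sum_congr rfl fun e _ => ?_
    rw [← sum_filter, ← card_eq_sum_ones, filter_mem_eq_inter, univ_inter]
  have hnum : #(univ : Finset (Numbering (Fin n))) = n ! := by
    rw [Finset.card_univ, Fintype.card_numbering, Fintype.card_fin]
  have hle : ∑ f, #(Bf f) ≤ K * n ! + ∑ f, bad f := by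
    calc ∑ f, #(Bf f) ≤ ∑ f, (K + bad f) := sum_le_sum fun f _ =>
          card_le_card_admissible_add hG hsparse (hBf f) (hch f)
      _ = _ := by rw [sum_add_distrib, sum_const, hnum, smul_eq_mul, mul_comm]
  have hmul := mul_sum_card_conflicts_le (k := k) hB0 hd
  rw [← hbadsum, ← hcardsum] at hmul
  -- The bound is self-referential: n * bad ≤ 2d * (K * n! + bad) in total. As 4 * d ≤ n, the last
  -- term is absorbed by half of the left side.
  have hbad : n * ∑ f, bad f ≤ 4 * (d * (K * n !)) := by
    have h1 := Nat.mul_le_mul_left d hle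
    have h2 := Nat.mul_le_mul_right (∑ f, bad f) hdn
    rw [mul_add] at h1
    rw [mul_assoc] at h2
    omega
  have hbad' : (∑ f, bad f : ℝ) ≤ n ! * (4 * K * (d / n)) := by
    have hn' : (0 : ℝ) < n := by exact_mod_cast hn
    have : (n : ℝ) * ∑ f, (bad f : ℝ) ≤ 4 * (d * (K * n !)) := by exact_mod_cast hbad
    rw [show (n ! : ℝ) * (4 * K * (d / n)) = 4 * (d * (K * n !)) / n by field_simp,
      le_div_iff₀ hn']
    linarith
  have hchainle (f : Numbering (Fin n)) :
      ∑ x with f.IsPrefix x, Real.log (1 + ∑ i ∈ colorsOf B x, β i) ≤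
        omegaCrit G β + L * (K + 1) * bad f := by
    refine le_trans (le_of_eq ?_) (entropy_colorsOf_chain_le hG hsparse hβ hL (hBf f) (hch f))
    rw [Template.entropy, sum_filter]
    refine sum_congr rfl fun x _ => ?_
    split_ifs with hx
    · congr 3
      ext i
      simp [mem_colorsOf, Bf, hx]
    · have : colorsOf (Bf f) x = ∅ := by
        ext i
        simp [mem_colorsOf, Bf, hx]
      simp [this]
  have havg := factorial_mul_sum_le (X := Fin n)
    (fun x => Real.log (1 + ∑ i ∈ colorsOf B x, β i)) (fun x =>
      Real.log_nonneg (le_add_of_nonneg_right (sum_nonneg fun i _ => (hβ i).le)))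
    (Fintype.card_fin n)
  have hfac : (0 : ℝ) < n ! := by exact_mod_cast n.factorial_pos
  refine le_of_mul_le_mul_left (havg.trans ?_) hfac
  rw [mul_left_comm]
  refine mul_le_mul_of_nonneg_left ?_ (Nat.cast_nonneg _)
  calc ∑ f : Numbering (Fin n), ∑ x with f.IsPrefix x, Real.log (1 + ∑ i ∈ colorsOf B x, β i)
      ≤ ∑ f : Numbering (Fin n), (omegaCrit G β + L * (K + 1) * bad f) :=
        sum_le_sum fun f _ => hchainle f
    _ = n ! * omegaCrit G β + L * (K + 1) * ∑ f, (bad f : ℝ) := by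
        rw [sum_add_distrib, sum_const, hnum, nsmul_eq_mul, mul_sum]
    _ ≤ n ! * omegaCrit G β + L * (K + 1) * (n ! * (4 * K * (d / n))) := by gcongr
    _ = _ := by ring

/-! ### The upper bound -/

/-- The sum factorizes over x. The 1 inside the logarithm accounts for leaving x out of the subset.
-/
theorem sum_weight_piFinset {β : Fin m → ℝ} (hβ : ∀ i, 0 < β i) (T : Template m n) :
    ∑ c ∈ Fintype.piFinset (fun x => (T x).insertNone), weight β c = Real.exp (T.entropy β) := by
  have h (x : Cube n) : ∑ o ∈ (T x).insertNone, o.elim 1 β = 1 + ∑ i ∈ T x, β i :=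
    sum_insertNone _ _
  have h0 (x : Cube n) : 0 < 1 + ∑ i ∈ T x, β i :=
    add_pos_of_pos_of_nonneg one_pos (sum_nonneg fun i _ => (hβ i).le)
  rw [Template.entropy, Real.exp_sum]
  simp_rw [Real.exp_log (h0 _), ← h, weight]
  rw [prod_univ_sum]

theorem weight_pos {β : Fin m → ℝ} (hβ : ∀ i, 0 < β i) (c : ColoredSubset m n) :
    0 < weight β c := by
  refine prod_pos fun x _ => ?_
  cases c x with
  | none => exact one_pos
  | some i => exact hβ i

theorem mem_validSubsets {G : Set (List (Fin m))} {c : ColoredSubset m n} :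
    c ∈ validSubsets G n ↔ IsValid G c := by
  simp [validSubsets]

theorem measure_validSubsets_pos {k : ℕ} {G : Set (List (Fin m))}
    (hG : ∀ g ∈ G, 2 ≤ g.length ∧ g.length ≤ k) {β : Fin m → ℝ} (hβ : ∀ i, 0 < β i) (n : ℕ) :
    0 < measure β (validSubsets G n) := by
  refine sum_pos (fun c _ => weight_pos hβ c) ⟨fun _ => none, mem_validSubsets.2 ?_⟩
  rintro g hg ⟨x, -, hx⟩
  have := hx ⟨0, by have := hG g hg; omega⟩
  cases this

theorem measure_validSubsets_le {k d : ℕ} {G : Set (List (Fin m))} (hk : 1 ≤ k)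
    (hG : ∀ g ∈ G, 2 ≤ g.length ∧ g.length ≤ k) (hsparse : IsSparse G) {β : Fin m → ℝ}
    (hβ : ∀ i, 0 < β i) (hn : 0 < n) (hdn : 4 * d ≤ n) {t : ℝ} (ht : 0 ≤ t)
    (htd : 1 + ∑ i, β i ≤ t * (1 + t) ^ d) :
    measure β (validSubsets G n) ≤ Real.exp ((n.choose (n / 2) : ℝ) * (omegaCrit G β +
      Real.log (1 + ∑ i, β i) * (#(admissible G k) + 1) * (4 * #(admissible G k) * (d / n))) +
      Real.log (1 + ∑ i, β i) * (2 * #(admissible G k)) +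
      t * (2 ^ n * #(admissible G k))) := by
  classical
  set K := #(admissible G k) with hK
  set M := 1 + ∑ i, β i with hM
  set L := Real.log M with hLdef
  have hM1 : 1 ≤ M := le_add_of_nonneg_right (sum_nonneg fun i _ => (hβ i).le)
  have hM0 : 0 < M := by linarith
  have hL (s : Finset (Fin m)) : Real.log (1 + ∑ i ∈ s, β i) ≤ L := by
    refine Real.log_le_log (add_pos_of_pos_of_nonneg one_pos (sum_nonneg fun i _ => (hβ i).le)) ?_
    refine add_le_add_right ?_ 1
    exact sum_le_sum_of_subset_of_nonneg (subset_univ s) fun i _ _ => (hβ i).le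
  have hpow (j : ℕ) : M ^ j = Real.exp (L * j) := by
    rw [hLdef, mul_comm, Real.exp_nat_mul, Real.exp_log hM0]
  -- The empty and full sets lie on every maximal chain, so the estimate for pairs fails there.
  -- Their boundedly many vertices start in S instead.
  let A₀ : Finset (Cube n × RefinedColor m) :=
    ({x | x ≠ ∅ ∧ x ≠ univ} : Finset (Cube n)) ×ˢ admissible G k
  let S₀ : Finset (Cube n × RefinedColor m) := ({∅, univ} : Finset (Cube n)) ×ˢ admissible G k
  have hA₀ : #A₀ ≤ 2 ^ n * K := by
    rw [card_product]
    refine Nat.mul_le_mul_right _ ((card_filter_le _ _).trans ?_)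
    simp
  have hS₀ : #S₀ ≤ 2 * K := by
    rw [card_product]
    exact Nat.mul_le_mul_right _ card_le_two
  have key := sum_le_of_maxDegree_bound (validSubsets G n) (refinement k) (weight β) (Adj k)
    (not_adj_self k) (fun c _ u hu v hv => not_adj_of_mem_refinement hu hv) (d := d) (M := M)
    (l := 1 + t) (E := Real.exp ((n.choose (n / 2) : ℝ) * (omegaCrit G β +
      L * (K + 1) * (4 * K * (d / n))))) hM1 (by linarith) (by rw [pow_succ]; linarith)
    (fun c _ => (weight_pos hβ c).le) (Real.exp_pos _).le A₀ ?_ A₀ subset_rfl S₀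
  · have hall : validSubsets G n = {c ∈ validSubsets G n | refinement k c ⊆ A₀ ∪ S₀} := by
      refine (filter_true_of_mem fun c hc v hv => ?_).symm
      have := mem_admissible_of_mem_refinement hk (mem_validSubsets.1 hc) hv
      simp only [A₀, S₀, mem_union, mem_product, mem_filter, mem_univ, true_and, mem_insert,
        mem_singleton, this, and_true]
      tauto
    rw [measure, hall]
    refine key.trans ?_
    rw [Real.exp_add, Real.exp_add]
    have h1 : M ^ #S₀ ≤ Real.exp (L * (2 * K)) := by
      refine (pow_le_pow_right₀ hM1 hS₀).trans_eq ?_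
      rw [hpow]
      push_cast
      rfl
    have h2 : (1 + t) ^ #A₀ ≤ Real.exp (t * (2 ^ n * K)) := by
      refine (pow_le_pow_right₀ (by linarith) hA₀).trans ?_
      calc (1 + t) ^ (2 ^ n * K) ≤ (Real.exp t) ^ (2 ^ n * K) := by
            gcongr
            linarith [Real.add_one_le_exp t]
        _ = _ := by
          rw [← Real.exp_nat_mul, mul_comm]
          push_cast
          rfl
    gcongr
  · intro B hB hd S
    have hent : (colorsOf (B ∪ S)).entropy β ≤ (n.choose (n / 2) : ℝ) * (omegaCrit G β +
        L * (K + 1) * (4 * K * (d / n))) + L * #S := by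
      refine (entropy_colorsOf_union_le hβ hL B S).trans ?_
      gcongr
      refine entropy_colorsOf_le hG hsparse hβ hL (fun v hv => ?_) (fun v hv => ?_) hd hn hdn
      · exact (mem_product.1 (hB hv)).2
      · exact (mem_filter.1 (mem_product.1 (hB hv)).1).2
    rw [hpow, ← Real.exp_add]
    refine le_trans ?_ (Real.exp_le_exp.2 hent)
    rw [← sum_weight_piFinset hβ]
    -- A colored subset whose refinement lies in B ∪ S takes all its colors from `colorsOf (B ∪ S)`.
    refine sum_le_sum_of_subset_of_nonneg (fun c hc => ?_) fun c _ _ => (weight_pos hβ c).le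
    rw [mem_filter] at hc
    rw [Fintype.mem_piFinset]
    intro x
    rw [mem_insertNone]
    intro i hi
    exact mem_colorsOf.2 ⟨_, hc.2
      (mem_refinement.2 ⟨hi, rfl⟩ : (x, i, startWords k c x) ∈ refinement k c)⟩

theorem tendsto_choose_middle_atTop :
    Tendsto (fun n : ℕ => (n.choose (n / 2) : ℝ)) atTop atTop := by
  refine tendsto_atTop_mono' _ ?_ tendsto_natCast_atTop_atTop
  filter_upwards [eventually_ge_atTop 2] with n hn
  exact_mod_cast le_choose (by omega) (by omega)

theorem exists_log_measure_div_le {k : ℕ} {G : Set (List (Fin m))} (hk : 1 ≤ k)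
    (hG : ∀ g ∈ G, 2 ≤ g.length ∧ g.length ≤ k) (hsparse : IsSparse G) {β : Fin m → ℝ}
    (hβ : ∀ i, 0 < β i) :
    ∃ u : ℕ → ℝ, Tendsto u atTop (𝓝 (omegaCrit G β)) ∧ ∀ᶠ n in atTop,
      Real.log (measure β (validSubsets G n)) / n.choose (n / 2) ≤ u n := by
  set K := (#(admissible G k) : ℝ)
  set M := 1 + ∑ i, β i
  set L := Real.log M
  -- With d ≈ y⁴ and t = y⁻³, d / n is at most 1 / y, while (1 + t)^d ≥ exp(y / 4) beats M / t. Also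
  -- t * 2^n is o of the middle binomial coefficient, as t * √n = n^(-1/10).
  let y : ℕ → ℝ := fun n => (n : ℝ) ^ (1 / 5 : ℝ)
  have hy : Tendsto y atTop atTop :=
    (tendsto_rpow_atTop (by norm_num)).comp tendsto_natCast_atTop_atTop
  have hy5 (n : ℕ) : y n ^ 5 = n := by
    rw [← Real.rpow_natCast, ← Real.rpow_mul (Nat.cast_nonneg n)]
    norm_num
  have hz : Tendsto (fun n => (y n)⁻¹) atTop (𝓝 0) := tendsto_inv_atTop_zero.comp hy
  refine ⟨fun n => omegaCrit G β + L * (K + 1) * (4 * K * (y n)⁻¹) +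
    L * (2 * K) / n.choose (n / 2) + 4 * √((y n)⁻¹ + (y n)⁻¹ ^ 6) * K, ?_, ?_⟩
  · have h1 : Tendsto (fun n : ℕ => L * (2 * K) / (n.choose (n / 2) : ℝ)) atTop (𝓝 0) :=
      tendsto_const_nhds.div_atTop tendsto_choose_middle_atTop
    have h2 : Tendsto (fun n => √((y n)⁻¹ + (y n)⁻¹ ^ 6)) atTop (𝓝 0) := by
      have := (Real.continuous_sqrt.tendsto _).comp (hz.add (hz.pow 6))
      simpa [Function.comp_def] using this
    have := ((tendsto_const_nhds (x := omegaCrit G β)).add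
      ((hz.const_mul (4 * K)).const_mul (L * (K + 1)))).add h1 |>.add ((h2.const_mul 4).mul_const K)
    simpa using this
  · have hexp : ∀ᶠ n in atTop, M ≤ Real.exp (1 / 4 * y n) / y n ^ (3 : ℝ) :=
      ((tendsto_exp_mul_div_rpow_atTop 3 (1 / 4) (by norm_num)).comp hy).eventually_ge_atTop M
    filter_upwards [hexp, hy.eventually_ge_atTop 4, eventually_gt_atTop 0] with n hn hyn hn0
    have hy0 : 0 < y n := by linarith
    have hd : (⌊y n ^ 4⌋₊ : ℝ) ≤ y n ^ 4 := Nat.floor_le (by positivity)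
    have hd' : y n ^ 4 / 2 ≤ (⌊y n ^ 4⌋₊ : ℝ) := by
      have h1 := Nat.lt_floor_add_one (y n ^ 4)
      have h2 : (4 : ℝ) ^ 4 ≤ y n ^ 4 := by gcongr
      norm_num at h2
      linarith
    set d := ⌊y n ^ 4⌋₊
    set t := (y n ^ 3)⁻¹ with ht
    have ht0 : 0 < t := by positivity
    have ht1 : t ≤ 1 := inv_le_one_of_one_le₀ (one_le_pow₀ (by linarith))
    have hdn : 4 * d ≤ n := by
      have : (4 : ℝ) * d ≤ n := by
        rw [← hy5 n, pow_succ]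
        nlinarith [pow_pos hy0 4]
      exact_mod_cast this
    have htd : M ≤ t * (1 + t) ^ d := by
      have hlog : t / 2 ≤ Real.log (1 + t) := by
        refine le_trans ?_ (Real.one_sub_inv_le_log_of_pos (by linarith))
        rw [show 1 - (1 + t)⁻¹ = t / (1 + t) by field_simp; ring]
        gcongr
        linarith
      have hpow : Real.exp (1 / 4 * y n) ≤ (1 + t) ^ d := by
        rw [← Real.exp_log (show 0 < 1 + t by linarith), ← Real.exp_nat_mul, Real.exp_le_exp]
        calc 1 / 4 * y n = y n ^ 4 / 2 * (t / 2) := by rw [ht]; field_simp; ring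
          _ ≤ d * Real.log (1 + t) := by gcongr
      calc M ≤ Real.exp (1 / 4 * y n) / y n ^ (3 : ℝ) := hn
        _ = t * Real.exp (1 / 4 * y n) := by
          rw [ht, div_eq_inv_mul]
          norm_cast
        _ ≤ _ := by gcongr
    have hub := measure_validSubsets_le hk hG hsparse hβ hn0 hdn ht0.le htd
    have hμ := measure_validSubsets_pos hG hβ n
    have hb : (0 : ℝ) < n.choose (n / 2) := by
      exact_mod_cast Nat.choose_pos (Nat.div_le_self n 2)
    have hlog := (Real.log_le_iff_le_exp hμ).2 hub
    rw [div_le_iff₀ hb]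
    have hK0 : 0 ≤ K := Nat.cast_nonneg _
    have hL0 : 0 ≤ L :=
      Real.log_nonneg (le_add_of_nonneg_right (sum_nonneg fun i _ => (hβ i).le))
    have hdn' : (d : ℝ) / n ≤ (y n)⁻¹ := by
      rw [← hy5 n, div_le_iff₀ (by positivity)]
      calc (d : ℝ) ≤ y n ^ 4 := hd
        _ = (y n)⁻¹ * y n ^ 5 := by field_simp
    have hsqrt : t * √(n + 1) = √((y n)⁻¹ + (y n)⁻¹ ^ 6) := by
      rw [← hy5 n, ← Real.sqrt_sq ht0.le, ← Real.sqrt_mul (sq_nonneg t)]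
      congr 1
      rw [ht]
      field_simp
    have h2n : t * (2 ^ n * K) ≤ 4 * √((y n)⁻¹ + (y n)⁻¹ ^ 6) * K * n.choose (n / 2) := by
      calc t * (2 ^ n * K) ≤ t * (4 * √(n + 1) * n.choose (n / 2) * K) := by
            gcongr
            exact two_pow_le_mul_choose n
        _ = 4 * (t * √(n + 1)) * K * n.choose (n / 2) := by ring
        _ = _ := by rw [hsqrt]
    calc Real.log (measure β (validSubsets G n)) ≤ _ := hlog
      _ ≤ n.choose (n / 2) * (omegaCrit G β + L * (K + 1) * (4 * K * (y n)⁻¹)) + L * (2 * K) +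
          4 * √((y n)⁻¹ + (y n)⁻¹ ^ 6) * K * n.choose (n / 2) := by gcongr
      _ = _ := by field_simp

/-! ### The lower bound -/

theorem exp_entropy_le_measure {G : Set (List (Fin m))} {β : Fin m → ℝ}
    (hβ : ∀ i, 0 < β i) {T : Template m n} (hT : T.Valid G) :
    Real.exp (T.entropy β) ≤ measure β (validSubsets G n) := by
  rw [← sum_weight_piFinset hβ]
  refine sum_le_sum_of_subset_of_nonneg (fun c hc => mem_validSubsets.2 ?_)
    fun c _ _ => (weight_pos hβ c).le
  rintro g hg ⟨x, hx, hxc⟩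
  obtain ⟨j, hj⟩ := Template.valid_iff.1 hT g hg x hx
  exact hj (mem_insertNone.1 (Fintype.mem_piFinset.1 hc (x j)) _ (hxc j))

/-- The colors which occur at the elements of cardinality `a`. -/
def Template.level {N : ℕ} (T : Template m N) (a : ℕ) : Finset (Fin m) :=
  ({x | #x = a} : Finset (Cube N)).biUnion T

/-- The template whose colors on the layers of `𝒫([n])` from the middle one upwards are those on the
layers of `T`. -/
def Template.spread {N : ℕ} (T : Template m N) (n : ℕ) : Template m n :=
  fun y => if n / 2 ≤ #y then T.level (#y - n / 2) else ∅

/-- A forbidden chain in the spread has strictly increasing cardinalities. The points of A on the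
corresponding layers then carry the same chain in T. -/
theorem Template.valid_spread {N : ℕ} {G : Set (List (Fin m))} {T : Template m N}
    (hT : T.Valid G) {A : Set (Cube N)} (hA : IsChain (· ⊆ ·) A) (hTA : T.SupportedOn A) (n : ℕ) :
    (T.spread n).Valid G := by
  rw [Template.valid_iff] at hT ⊢
  intro g hg y hy
  by_contra! h
  have hex (j) : ∃ x : Cube N, n / 2 + #x = #(y j) ∧ g.get j ∈ T x := by
    have := h j
    rw [Template.spread] at this
    split_ifs at this with hj
    · obtain ⟨x, hx, hxT⟩ := mem_biUnion.1 this
      rw [mem_filter] at hx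
      exact ⟨x, by omega, hxT⟩
    · simp at this
  choose x hx hxT using hex
  have hxA (j) : x j ∈ A := by
    by_contra hj
    have := hxT j
    rw [hTA _ hj] at this
    simp at this
  obtain ⟨j, hj⟩ := hT g hg x fun a b hab => lt_of_isChain_of_card_lt hA (hxA a) (hxA b) (by
    have := card_lt_card (hy hab)
    rw [← hx, ← hx] at this
    omega)
  exact hj (hxT j)

theorem Template.entropy_eq_sum_level {N : ℕ} {T : Template m N} {A : Set (Cube N)}
    (hA : IsChain (· ⊆ ·) A) (hTA : T.SupportedOn A) (β : Fin m → ℝ) :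
    T.entropy β = ∑ a ∈ range (N + 1), Real.log (1 + ∑ i ∈ T.level a, β i) := by
  rw [Template.entropy, ← sum_fiberwise_of_maps_to (s := univ) (t := range (N + 1))
    (g := fun x : Cube N => #x)]
  · refine sum_congr rfl fun a _ => ?_
    by_cases h : ∃ x : Cube N, #x = a ∧ T x ≠ ∅
    · obtain ⟨x, hx, hxT⟩ := h
      have hother (z : Cube N) (hz : #z = a) (hzx : z ≠ x) : T z = ∅ := by
        by_contra hzT
        refine hzx (injOn_card_of_isChain hA ?_ ?_ (hz.trans hx.symm))
        · by_contra hz'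
          exact hzT (hTA z hz')
        · by_contra hx'
          exact hxT (hTA x hx')
      have hlevel : T.level a = T x := by
        ext i
        simp only [Template.level, mem_biUnion, mem_filter, mem_univ, true_and]
        refine ⟨fun ⟨z, hz, hi⟩ => ?_, fun hi => ⟨x, hx, hi⟩⟩
        by_cases hzx : z = x
        · rwa [← hzx]
        · rw [hother z hz hzx] at hi
          simp at hi
      rw [hlevel]
      refine sum_eq_single_of_mem x (by simpa using hx) fun z hz hzx => ?_
      rw [hother z (by simpa using hz) hzx]
      simp
    · push Not at h
      have hlevel : T.level a = ∅ := by
        ext i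
        simp only [Template.level, mem_biUnion, mem_filter, mem_univ, true_and, notMem_empty,
          iff_false]
        rintro ⟨z, hz, hi⟩
        rw [h z hz] at hi
        simp at hi
      rw [hlevel]
      refine (sum_eq_zero fun z hz => ?_).trans (by simp)
      rw [h z (by simpa using hz)]
      simp
  · intro x _
    rw [mem_range, Nat.lt_succ_iff]
    simpa using card_le_univ x

theorem Template.sum_choose_mul_le_entropy_spread {N : ℕ} {β : Fin m → ℝ} (hβ : ∀ i, 0 < β i)
    (T : Template m N) (n : ℕ) :
    ∑ a ∈ range (N + 1), (n.choose (n / 2 + a) : ℝ) * Real.log (1 + ∑ i ∈ T.level a, β i) ≤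
      (T.spread n).entropy β := by
  have h0 (s : Finset (Fin m)) : 0 ≤ Real.log (1 + ∑ i ∈ s, β i) :=
    Real.log_nonneg (le_add_of_nonneg_right (sum_nonneg fun i _ => (hβ i).le))
  have h := sum_fiberwise_le_sum_of_sum_fiber_nonneg (s := (univ : Finset (Cube n)))
    (t := (range (N + 1)).image fun a => n / 2 + a) (g := fun y => #y)
    (f := fun y => Real.log (1 + ∑ i ∈ T.spread n y, β i))
    fun _ _ => sum_nonneg fun _ _ => h0 _
  rw [sum_image fun a _ b _ hab => by simpa using hab] at h
  refine le_trans (le_of_eq (sum_congr rfl fun a _ => ?_)) h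
  have hcard : #{y : Cube n | #y = n / 2 + a} = n.choose (n / 2 + a) := by
    rw [← powerset_univ, ← powersetCard_eq_filter, card_powersetCard, card_univ,
      Fintype.card_fin]
  rw [← hcard, ← nsmul_eq_mul, ← sum_const]
  refine sum_congr rfl fun y hy => ?_
  have hy' : #y = n / 2 + a := by simpa using hy
  rw [Template.spread, if_pos (by omega), hy', Nat.add_sub_cancel_left]

theorem exists_le_log_measure_div {k : ℕ} {G : Set (List (Fin m))}
    (hG : ∀ g ∈ G, 2 ≤ g.length ∧ g.length ≤ k) (hsparse : IsSparse G) {β : Fin m → ℝ}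
    (hβ : ∀ i, 0 < β i) :
    ∃ u : ℕ → ℝ, Tendsto u atTop (𝓝 (omegaCrit G β)) ∧ ∀ n,
      u n ≤ Real.log (measure β (validSubsets G n)) / n.choose (n / 2) := by
  obtain ⟨N, T, hT, ⟨A, hA, hTA⟩, hω⟩ := (isGreatest_omegaCrit hG hsparse β).1
  refine ⟨fun n => ∑ a ∈ range (N + 1), (n.choose (n / 2 + a) : ℝ) / n.choose (n / 2) *
    Real.log (1 + ∑ i ∈ T.level a, β i), ?_, fun n => ?_⟩
  · rw [hω, Template.entropy_eq_sum_level hA hTA]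
    refine tendsto_finsetSum _ fun a _ => ?_
    simpa using (tendsto_choose_div_choose_middle a).mul_const
      (Real.log (1 + ∑ i ∈ T.level a, β i))
  · have hb : (0 : ℝ) < n.choose (n / 2) := by
      exact_mod_cast Nat.choose_pos (Nat.div_le_self n 2)
    rw [le_div_iff₀ hb, sum_mul]
    have hle := exp_entropy_le_measure hβ (T.valid_spread hT hA hTA n)
    refine le_trans ?_ ((Real.le_log_iff_exp_le ((Real.exp_pos _).trans_le hle)).2 hle)
    refine le_trans (le_of_eq (sum_congr rfl fun a _ => ?_))
      (T.sum_choose_mul_le_entropy_spread hβ n)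
    field_simp

theorem tendsto_log_measure_div {k : ℕ} {G : Set (List (Fin m))} (hk : 1 ≤ k)
    (hG : ∀ g ∈ G, 2 ≤ g.length ∧ g.length ≤ k) (hsparse : IsSparse G) {β : Fin m → ℝ}
    (hβ : ∀ i, 0 < β i) :
    Tendsto (fun n : ℕ => Real.log (measure β (validSubsets G n)) / n.choose (n / 2)) atTop
      (𝓝 (omegaCrit G β)) := by
  obtain ⟨u, hu, hu'⟩ := exists_le_log_measure_div hG hsparse hβ
  obtain ⟨v, hv, hv'⟩ := exists_log_measure_div_le hk hG hsparse hβ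
  exact tendsto_of_tendsto_of_tendsto_of_le_of_le' hu hv (.of_forall hu') hv'

theorem measure_validSubsets_of_zero {k : ℕ} {G : Set (List (Fin 0))}
    (hG : ∀ g ∈ G, 2 ≤ g.length ∧ g.length ≤ k) (β : Fin 0 → ℝ) (n : ℕ) :
    measure β (validSubsets G n) = 1 := by
  have h : validSubsets G n = {fun _ => none} := by
    ext c
    rw [mem_validSubsets, mem_singleton]
    refine ⟨fun _ => Subsingleton.elim _ _, fun _ g hg => ?_⟩
    have := hG g hg
    rw [Subsingleton.elim g []] at this
    simp at this
  simp [measure, h, weight]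

end ColoredChains

theorem mainTheorem1 (m k : ℕ) (G : Set (List (Fin m)))
    (hG : ∀ g ∈ G, 2 ≤ g.length ∧ g.length ≤ k)
    (hsparse : ColoredChains.IsSparse G)
    (β : Fin m → ℝ) (hβ : ∀ i, 0 < β i) :
    IsGreatest (ColoredChains.chainEntropies G β) (ColoredChains.omegaCrit G β) ∧
    ∃ ε : ℕ → ℝ, Tendsto ε atTop (𝓝 0) ∧
      ∀ n : ℕ, ColoredChains.measure β (ColoredChains.validSubsets G n) =
        Real.exp (ColoredChains.omegaCrit G β * (n.choose (n / 2) : ℝ) * (1 + ε n)) := by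
  have hmax := ColoredChains.isGreatest_omegaCrit hG hsparse β
  refine ⟨hmax, ?_⟩
  -- Without colors ω_crit is 0 and cannot be divided by; the measure is then exactly 1. Otherwise ε
  -- is solved for from the equation.
  rcases Nat.eq_zero_or_pos m with rfl | hm
  · obtain ⟨N, T, -, -, hω⟩ := hmax.1
    have hω0 : ColoredChains.omegaCrit G β = 0 := by
      rw [hω]
      refine Finset.sum_eq_zero fun x _ => ?_
      rw [Subsingleton.elim (T x) ∅, Finset.sum_empty, add_zero, Real.log_one]
    refine ⟨fun _ => 0, tendsto_const_nhds, fun n => ?_⟩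
    rw [ColoredChains.measure_validSubsets_of_zero hG, hω0]
    simp
  · have hω := ColoredChains.omegaCrit_pos hG hsparse hβ ⟨0, hm⟩
    have hk : 1 ≤ k := by
      obtain ⟨l, hl⟩ := hsparse ⟨0, hm⟩
      have := hG _ hl
      omega
    refine ⟨fun n => Real.log (ColoredChains.measure β (ColoredChains.validSubsets G n)) /
      n.choose (n / 2) / ColoredChains.omegaCrit G β - 1, ?_, fun n => ?_⟩
    · have h := ((ColoredChains.tendsto_log_measure_div hk hG hsparse hβ).div_const
        (ColoredChains.omegaCrit G β)).sub_const 1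
      rwa [div_self hω.ne', sub_self] at h
    · have hb : (0 : ℝ) < n.choose (n / 2) := by
        exact_mod_cast Nat.choose_pos (Nat.div_le_self n 2)
      rw [add_sub_cancel, div_div, mul_comm (n.choose (n / 2) : ℝ),
        mul_div_cancel₀ _ (by positivity),
        Real.exp_log (ColoredChains.measure_validSubsets_pos hG hβ n)]
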